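/- Let $c$ be a positive integer and $d$ a non-negative integer. Let $G$ be a finite group that is $d$-generated (that is, there are elements $g_1,\dots,g_d\in G$, not necessarily distinct, with $G=\langle g_1,\dots,g_d\rangle$), and assume that every orbit of the natural action of the automorphism group $\operatorname{Aut}(G)$ on $G$ has length at most $c$. Then \[ |G|\leqslant c^{\,d\cdot c^d\cdot(1+\lfloor d\log_2 c\rfloor)}+1. \] -/

import Mathlib

open Subgroup
open scoped IsMulCommutative

/-! An automorphism is determined on `d` generators, so `m = |G : Z(G)| ≤ |Aut G| ≤ c ^ d`. The
transfer into `Z(G)` is `x ↦ x ^ m`, so its image `T` is abelian of rank at most `d`. Power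
automorphisms put at least `φ (orderOf (g ^ m))` elements in the orbit of `g`; as `n ≤ 2 * φ n ^ 2`,
`T` has exponent at most `2 * c ^ 2`. The quotient of `Z(G)` by its `m`-th powers has exponent
dividing `m` and, by Schreier, rank at most `m * d`. Both orders are thus bounded. -/

theorem Nat.le_totient_sq_of_odd (n : ℕ) (hn : Odd n) : n ≤ n.totient ^ 2 := by
  induction n using Nat.recOnPosPrimePosCoprime with
  | zero => simp
  | one => simp
  | prime_pow p k hp hk =>
    rw [Nat.totient_prime_pow hp hk]
    obtain ⟨j, rfl⟩ : ∃ j, k = j + 1 := ⟨k - 1, by omega⟩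
    have hp3 : 3 ≤ p := by
      have h2 := hp.two_le
      rcases h2.lt_or_eq with h | h
      · exact h
      · subst h
        exact absurd hn (by simp [pow_succ])
    obtain ⟨q, rfl⟩ : ∃ q, p = q + 1 := ⟨p - 1, by omega⟩
    simp only [Nat.add_sub_cancel, mul_pow, pow_succ _ j]
    have h1 : (q + 1) ^ j ≤ ((q + 1) ^ j) ^ 2 := Nat.le_self_pow two_ne_zero _
    have h2 : q + 1 ≤ q ^ 2 := by nlinarith
    exact Nat.mul_le_mul h1 h2
  | coprime a b ha hb hab iha ihb =>
    rw [Nat.odd_mul] at hn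
    rw [Nat.totient_mul hab, mul_pow]
    exact Nat.mul_le_mul (iha hn.1) (ihb hn.2)

theorem Nat.le_two_mul_totient_sq (n : ℕ) : n ≤ 2 * n.totient ^ 2 := by
  rcases Nat.eq_zero_or_pos n with rfl | hpos
  · simp
  obtain ⟨k, m, hm, rfl⟩ := Nat.exists_eq_two_pow_mul_odd hpos.ne'
  rw [Nat.totient_mul ((Nat.coprime_two_left.2 hm).pow_left k), mul_pow, ← mul_assoc]
  refine Nat.mul_le_mul ?_ (Nat.le_totient_sq_of_odd m hm)
  rcases k with _ | j
  · simp
  · rw [Nat.totient_prime_pow_succ Nat.prime_two, pow_succ]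
    have := Nat.le_self_pow two_ne_zero (2 ^ j)
    simp only [Nat.add_one_sub_one, mul_one]
    omega

theorem ZMod.totient_le_card_ker_unitsMap (m n : ℕ) [NeZero m] [NeZero n] :
    n.totient ≤ Nat.card (ZMod.unitsMap (dvd_mul_right m n)).ker := by
  have hpos : 0 < m.totient := Nat.totient_pos.2 (NeZero.pos m)
  have h1 := (ZMod.unitsMap (dvd_mul_right m n)).ker.card_mul_index
  rw [Subgroup.index_ker, MonoidHom.range_eq_top.2 (ZMod.unitsMap_surjective _),
    Nat.card_congr Subgroup.topEquiv.toEquiv, Nat.card_eq_fintype_card (α := (ZMod m)ˣ),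
    Nat.card_eq_fintype_card (α := (ZMod (m * n))ˣ), ZMod.card_units_eq_totient,
    ZMod.card_units_eq_totient] at h1
  have h2 := Nat.totient_super_multiplicative m n
  rw [← h1, mul_comm] at h2
  exact Nat.le_of_mul_le_mul_right h2 hpos

section

variable {G : Type*} [Group G] [Finite G]

/-- With `k = 1 + m * t`, `z ^ k` is `z` times the `t`-th power of its transfer, a central factor
multiplicative in `z`. -/
theorem mul_pow_of_modEq_one_index_center {k : ℕ} (hk : k ≡ 1 [MOD (center G).index]) (x y : G) :
    (x * y) ^ k = x ^ k * y ^ k := by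
  obtain ⟨t, ht⟩ := (Nat.modEq_iff_dvd.1 hk.symm)
  have key : ∀ z : G, z ^ k = z * ((MonoidHom.transferCenterPow G z) ^ t : center G) := by
    intro z
    rw [← zpow_natCast, show (k : ℤ) = 1 + (center G).index * t by push_cast at ht; linarith,
      zpow_add, zpow_one, zpow_mul, zpow_natCast, Subgroup.coe_zpow,
      MonoidHom.transferCenterPow_apply]
  have hcomm := mem_center_iff.1 ((MonoidHom.transferCenterPow G x) ^ t : center G).2 y
  rw [key, key, key, map_mul, (Commute.all _ _).mul_zpow, Subgroup.coe_mul, mul_assoc, mul_assoc, ← mul_assoc y,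
    hcomm, mul_assoc]

/-- Raising to a power `k ≡ 1` modulo `|G : Z(G)|`, with `k` coprime to `|G|`, is an
automorphism. -/
theorem pow_mem_orbit_mulAut {k : ℕ} (hk : k ≡ 1 [MOD (center G).index])
    (hcop : (Nat.card G).Coprime k) (g : G) : g ^ k ∈ MulAction.orbit (MulAut G) g :=
  ⟨{ powCoprime hcop with
      map_mul' := fun x y => mul_pow_of_modEq_one_index_center hk x y }, rfl⟩

theorem totient_orderOf_pow_index_center_le (g : G) :
    (orderOf (g ^ (center G).index)).totient ≤ (MulAction.orbit (MulAut G) g).ncard := by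
  set m := (center G).index with hm
  set n := orderOf (g ^ m) with hn
  have : NeZero m := ⟨FiniteIndex.index_ne_zero⟩
  have : NeZero n := ⟨(orderOf_pos _).ne'⟩
  have : NeZero (Nat.card G) := ⟨Nat.card_pos.ne'⟩
  refine (ZMod.totient_le_card_ker_unitsMap m n).trans ?_
  have hval : ∀ u : (ZMod.unitsMap (dvd_mul_right m n)).ker,
      ((u : (ZMod (m * n))ˣ) : ZMod (m * n)).val ≡ 1 [MOD m] := by
    rintro ⟨u, hu⟩
    rw [← ZMod.natCast_eq_natCast_iff]
    have h := congrArg Units.val (MonoidHom.mem_ker.1 hu)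
    rw [ZMod.unitsMap_val, ← ZMod.natCast_val] at h
    simpa using h
  have hmem : ∀ u : (ZMod.unitsMap (dvd_mul_right m n)).ker,
      g ^ ((u : (ZMod (m * n))ˣ) : ZMod (m * n)).val ∈ MulAction.orbit (MulAut G) g := by
    intro u
    -- Lifting the unit makes the exponent coprime to `|G|` without changing the power of `g`.
    obtain ⟨v, hv⟩ := ZMod.unitsMap_surjective (dvd_mul_right (m * n) (Nat.card G)) u.1
    have hvu : (v : ZMod (m * n * Nat.card G)).val ≡
        ((u : (ZMod (m * n))ˣ) : ZMod (m * n)).val [MOD m * n] := by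
      rw [← ZMod.natCast_eq_natCast_iff, ← hv, ZMod.unitsMap_val, ← ZMod.natCast_val]
      simp
    have hg : g ^ ((u : (ZMod (m * n))ˣ) : ZMod (m * n)).val =
        g ^ (v : ZMod (m * n * Nat.card G)).val := by
      rw [pow_eq_pow_iff_modEq]
      refine (hvu.of_dvd (orderOf_dvd_of_pow_eq_one ?_)).symm
      rw [pow_mul, hn, pow_orderOf_eq_one]
    rw [hg]
    exact pow_mem_orbit_mulAut ((hvu.of_dvd (dvd_mul_right m n)).trans (hval u))
      (Nat.Coprime.coprime_dvd_left (dvd_mul_left _ _) (ZMod.val_coe_unit_coprime v).symm) g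
  rw [← Nat.card_coe_set_eq]
  refine Nat.card_le_card_of_injective
    (fun u => (⟨_, hmem u⟩ : MulAction.orbit (MulAut G) g)) fun u w huw => ?_
  have huw' := congrArg Subtype.val huw
  simp only at huw'
  obtain ⟨t, ht⟩ := Nat.modEq_iff_dvd.1 ((hval u).trans (hval w).symm)
  have h1 : (g ^ m) ^ t = 1 := by
    rw [← zpow_natCast g m, ← zpow_mul, ← ht, zpow_sub, zpow_natCast, zpow_natCast, huw',
      mul_inv_cancel]
  have h2 : ((m * n : ℕ) : ℤ) ∣
      (((w : (ZMod (m * n))ˣ) : ZMod (m * n)).val : ℤ) -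
        ((u : (ZMod (m * n))ˣ) : ZMod (m * n)).val := by
    rw [ht]
    push_cast
    exact mul_dvd_mul_left _ (orderOf_dvd_iff_zpow_eq_one.2 h1)
  have h3 := (ZMod.natCast_eq_natCast_iff _ _ _).2 (Nat.modEq_iff_dvd.2 h2)
  rw [ZMod.natCast_zmod_val, ZMod.natCast_zmod_val] at h3
  exact Subtype.ext (Units.ext h3)

theorem card_mulAut_le_pow {d c : ℕ} (g : Fin d → G) (hg : closure (Set.range g) = ⊤)
    (hc : ∀ x : G, (MulAction.orbit (MulAut G) x).ncard ≤ c) : Nat.card (MulAut G) ≤ c ^ d := by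
  let f : MulAut G → ∀ i, MulAction.orbit (MulAut G) (g i) := fun a i => ⟨a • g i, ⟨a, rfl⟩⟩
  have hf : Function.Injective f := by
    intro a b hab
    refine MulEquiv.toMonoidHom_injective (MonoidHom.eq_of_eqOn_dense hg ?_)
    rintro _ ⟨i, rfl⟩
    exact congrArg Subtype.val (congrFun hab i)
  refine (Nat.card_le_card_of_injective f hf).trans ?_
  rw [Nat.card_pi]
  refine (Finset.prod_le_pow_card _ _ c fun i _ => ?_).trans (by simp)
  rw [Nat.card_coe_set_eq]
  exact hc _

theorem index_center_le_card_mulAut : (center G).index ≤ Nat.card (MulAut G) := by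
  have h : (MulAut.conj (G := G)).ker = center G := by
    ext x
    simp only [MonoidHom.mem_ker, mem_center_iff, MulEquiv.ext_iff, MulAut.conj_apply,
      MulAut.one_apply, mul_inv_eq_iff_eq_mul]
    exact forall_congr' fun y => eq_comm
  rw [← h, index_ker]
  exact Nat.card_le_card_of_injective _ Subtype.val_injective

theorem pos_of_card_orbit_mulAut_le {c : ℕ}
    (hc : ∀ x : G, (MulAction.orbit (MulAut G) x).ncard ≤ c) : 0 < c :=
  lt_of_lt_of_le ((Set.ncard_pos (Set.toFinite _)).2 (MulAction.nonempty_orbit 1)) (hc 1)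

theorem card_le_of_card_orbit_mulAut_le {d c : ℕ} (hd : Group.rank G ≤ d)
    (hc : ∀ x : G, (MulAction.orbit (MulAut G) x).ncard ≤ c) :
    Nat.card G ≤ (center G).index * (center G).index ^ ((center G).index * d) *
      (2 * c ^ 2) ^ d := by
  set m := (center G).index with hm
  have hm0 : 0 < m := Nat.pos_of_ne_zero FiniteIndex.index_ne_zero
  have hc0 : 0 < c := pos_of_card_orbit_mulAut_le hc
  set T := (MonoidHom.transferCenterPow G).range with hT
  let P := ((MonoidHom.transferCenterPow G).comp (center G).subtype).range
  have hPT : Nat.card P ≤ Nat.card T := by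
    refine Nat.card_le_card_of_injective (inclusion ?_) (inclusion_injective _)
    rintro _ ⟨z, rfl⟩
    exact ⟨z, rfl⟩
  have hTc : Nat.card T ≤ (2 * c ^ 2) ^ d := by
    obtain ⟨⟨_, g, rfl⟩, hg⟩ :=
      Monoid.exists_orderOf_eq_exponent (G := T) (Monoid.ExponentExists.of_finite)
    have hexp : Monoid.exponent T ≤ 2 * c ^ 2 := by
      rw [← hg, ← orderOf_coe, ← orderOf_coe, MonoidHom.transferCenterPow_apply]
      refine (Nat.le_two_mul_totient_sq _).trans ?_
      gcongr
      exact (totient_orderOf_pow_index_center_le g).trans (hc g)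
    refine (Nat.le_of_dvd (pow_pos (Nat.pos_of_ne_zero Monoid.exponent_ne_zero_of_finite) _)
      (card_dvd_exponent_pow_rank T)).trans ?_
    exact (Nat.pow_le_pow_left hexp _).trans
      (Nat.pow_le_pow_right (by positivity) (Group.rank_range_le.trans hd))
  have hquot : P.index ≤ m ^ (m * d) := by
    refine (Nat.le_of_dvd (pow_pos hm0 _) (card_dvd_exponent_pow_rank' (center G ⧸ P)
      (n := m) ?_)).trans (Nat.pow_le_pow_right hm0 ?_)
    · intro q
      obtain ⟨z, rfl⟩ := QuotientGroup.mk_surjective q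
      rw [← QuotientGroup.mk_pow, QuotientGroup.eq_one_iff]
      exact ⟨z, Subtype.ext rfl⟩
    · refine (Group.rank_le_of_surjective (QuotientGroup.mk' P)
        (QuotientGroup.mk'_surjective P)).trans ((rank_le_index_mul_rank _).trans ?_)
      gcongr
  rw [← (center G).index_mul_card, ← P.index_mul_card, ← mul_assoc]
  gcongr
  exact hPT.trans hTc

end

/-- A group with trivial automorphism group has order at most two. -/
theorem card_le_two_of_subsingleton_mulAut {G : Type*} [Group G] [Finite G]
    (h : Subsingleton (MulAut G)) : Nat.card G ≤ 2 := by
  have hcomm : ∀ x y : G, x * y = y * x := fun x y => by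
    have := DFunLike.congr_fun (Subsingleton.elim (MulAut.conj x) 1) y
    simpa [mul_inv_eq_iff_eq_mul] using this
  let : CommGroup G := { mul_comm := hcomm }
  have hsq : ∀ x : Additive G, 2 • x = 0 := fun x => by
    have := DFunLike.congr_fun (Subsingleton.elim (MulEquiv.inv G) 1) x.toMul
    have h' : x.toMul⁻¹ = x.toMul := this
    have h'' : x.toMul ^ 2 = 1 := by
      rw [sq]
      nth_rw 1 [← h']
      exact inv_mul_cancel _
    exact h''
  let : Module (ZMod 2) (Additive G) := AddCommGroup.zmodModule hsq
  by_contra hcard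
  have hcard' : 2 < Nat.card G := not_le.1 hcard
  have : Nontrivial G := Finite.one_lt_card_iff_nontrivial.1 (by omega)
  obtain ⟨a, ha⟩ := exists_ne (0 : Additive G)
  obtain ⟨b, hb⟩ : ∃ b, b ∉ Submodule.span (ZMod 2) {a} := by
    by_contra! hspan
    have hle : Nat.card (Additive G) ≤ Nat.card (ZMod 2) :=
      Nat.card_le_card_of_surjective (fun r : ZMod 2 => r • a)
        fun b => Submodule.mem_span_singleton.1 (hspan b)
    rw [Nat.card_zmod] at hle
    exact hcard hle
  obtain ⟨f, hfb, hf⟩ := Submodule.exists_le_ker_of_notMem hb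
  have hfa : f a = 0 := hf (Submodule.mem_span_singleton_self a)
  -- The transvection `x ↦ x + f x • a` moves `b`.
  have h2 := DFunLike.congr_fun (Subsingleton.elim
    (MulEquiv.toAdditive.symm (LinearEquiv.transvection hfa).toAddEquiv : MulAut G) 1) b.toMul
  have h3 : b + f b • a = b := h2
  rw [add_eq_left, smul_eq_zero] at h3
  exact h3.elim hfb ha

theorem theorem1p2 {G : Type*} [Group G] [Finite G] (d c : ℕ)
    (hd : ∃ g : Fin d → G, Subgroup.closure (Set.range g) = ⊤)
    (hc : ∀ x : G, (MulAction.orbit (MulAut G) x).ncard ≤ c) :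
    Nat.card G ≤ c ^ (d * c ^ d * (1 + ⌊(d : ℝ) * Real.logb 2 (c : ℝ)⌋₊)) + 1 := by
  classical
  obtain ⟨g, hg⟩ := hd
  have hc0 : 0 < c := pos_of_card_orbit_mulAut_le hc
  have haut := card_mulAut_le_pow g hg hc
  have hrank : Group.rank G ≤ d := by
    have h := Group.rank_le (S := Finset.univ.image g) (by simpa using hg)
    exact h.trans (Finset.card_image_le.trans (by simp))
  rcases Nat.eq_or_lt_of_le (Nat.succ_le_of_lt hc0) with rfl | hc2
  · rw [Nat.succ_eq_add_one, zero_add, one_pow] at haut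
    rw [Nat.succ_eq_add_one, zero_add, one_pow]
    exact card_le_two_of_subsingleton_mulAut (Finite.card_le_one_iff_subsingleton.1 haut)
  replace hc2 : 2 ≤ c := hc2
  have hfloor : d ≤ ⌊(d : ℝ) * Real.logb 2 (c : ℝ)⌋₊ := by
    refine Nat.le_floor (le_mul_of_one_le_right d.cast_nonneg ?_)
    rw [Real.le_logb_iff_rpow_le one_lt_two (by positivity), Real.rpow_one]
    exact_mod_cast hc2
  have hbound := card_le_of_card_orbit_mulAut_le hrank hc
  have h2c : (2 * c ^ 2) ^ d ≤ c ^ (3 * d) := by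
    rw [pow_mul]
    exact Nat.pow_le_pow_left (by rw [pow_succ' c 2]; gcongr) d
  refine le_add_right (LE.le.trans ?_
    (Nat.pow_le_pow_right hc0 (Nat.mul_le_mul_left (d * c ^ d) (Nat.add_le_add_left hfloor 1))))
  -- The final estimate absorbs a constant 4 into `c ^ d`, which needs `d ≥ 2`; for `d ≤ 1` the
  -- group is cyclic and `m = 1`.
  rcases le_or_gt d 1 with hd1 | hd2
  · have hcyc : IsCyclic G := by
      have : Subsingleton (Fin d) := by
        rw [← Finite.card_le_one_iff_subsingleton]; simpa using hd1
      rcases isEmpty_or_nonempty (Fin d) with h | ⟨⟨i⟩⟩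
      · rw [Set.range_eq_empty, Subgroup.closure_empty] at hg
        have : Subsingleton G := Subgroup.subsingleton_iff.1 (subsingleton_iff_bot_eq_top.1 hg)
        infer_instance
      · refine ⟨g i, fun x => ?_⟩
        change x ∈ zpowers (g i)
        rw [zpowers_eq_closure, ← show Set.range g = {g i} from ?_, hg]
        · exact mem_top x
        · ext y
          simp only [Set.mem_range, Set.mem_singleton_iff]
          exact ⟨fun ⟨j, hj⟩ => by rw [← hj, Subsingleton.elim j i], fun hy => ⟨i, hy.symm⟩⟩
    have hm : (center G).index = 1 := by
      let := IsCyclic.commGroup (α := G)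
      rw [index_eq_one]
      exact CommGroup.center_eq_top
    rw [hm, one_pow, one_mul, one_mul] at hbound
    refine (hbound.trans h2c).trans (Nat.pow_le_pow_right hc0 ?_)
    interval_cases d
    · simp
    · simp only [pow_one]; omega
  · have hm := index_center_le_card_mulAut.trans haut
    have hN : 4 ≤ c ^ d := (Nat.pow_le_pow_left hc2 2).trans (Nat.pow_le_pow_right hc0 hd2)
    set N := c ^ d with hNdef
    calc Nat.card G ≤ _ := hbound
      _ ≤ N * N ^ (N * d) * c ^ (3 * d) := by
        have : (center G).index ^ ((center G).index * d) ≤ N ^ (N * d) :=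
          (Nat.pow_le_pow_left hm _).trans
            (Nat.pow_le_pow_right (by omega) (Nat.mul_le_mul_right d hm))
        gcongr
      _ = c ^ (d * (4 + N * d)) := by
        conv_lhs => rw [hNdef]
        rw [← hNdef, ← pow_mul, ← pow_add, ← pow_add]
        congr 1
        ring
      _ ≤ _ := by
        refine Nat.pow_le_pow_right hc0 ?_
        rw [mul_assoc]
        refine Nat.mul_le_mul_left d ?_
        rw [mul_add, mul_one]
        omega
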